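/- Let $A=\{0,1\}$. A bi-infinite word $x=(x_i)_{i\in\mathbb Z}\in A^{\mathbb Z}$ is \emph{aperiodic} if there are no $N\in\mathbb Z$, $p\ge 1$ with $x_n=x_{n+p}$ for all $n\ge N$, and no $N\in\mathbb Z$, $p\ge 1$ with $x_n=x_{n-p}$ for all $n\le N$. It is \emph{Sturmian} if it is aperiodic and has exactly $n+1$ distinct factors (finite blocks of consecutive letters) of length $n$, for every $n\ge 0$. Such a word has, for every $n$, exactly one left-special factor $l_n(x)$ of length $n$ (i.e. such that $0\,l_n(x)$ and $1\,l_n(x)$ are both factors of $x$) and exactly one right-special factor $r_n(x)$ of length $n$ (i.e. such that $r_n(x)\,0$ and $r_n(x)\,1$ are both factors of $x$). A Sturmian word $x$ is \emph{characteristic} if $x_{-n}\cdots x_{n+1}=r_n(x)\,01\,l_n(x)$ for all $n\ge 0$, or $x_{-n}\cdots x_{n+1}=r_n(x)\,10\,l_n(x)$ for all $n\ge 0$; it is \emph{characteristic up to a finite shift} if $(x_{i+k})_{i\in\mathbb Z}$ is characteristic for some $k\in\mathbb Z$. A set $\Gamma\subseteq\mathbb Z$ is a \emph{string attractor} of $x$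 if every non-empty factor $w$ of $x$ has an occurrence $w=x_i x_{i+1}\cdots x_{i+|w|-1}$ with $\{i,\dots,i+|w|-1\}\cap\Gamma\neq\emptyset$. The \emph{span} of $x$ is $\mathrm{span}(x)=\inf\{\sup\Gamma-\inf\Gamma \mid \Gamma \text{ is a string attractor of } x\}\in[0,\infty]$. A \emph{Sturmian shift space} is the closure, in the product topology of $\{0,1\}^{\mathbb Z}$, of the set $\{(x_{i+k})_{i\in\mathbb Z} \mid k\in\mathbb Z\}$ for some Sturmian word $x$. Theorem. Let $x\in\{0,1\}^{\mathbb Z}$ be a Sturmian word. Then $\mathrm{span}(x)=1$ if $x$ is characteristic up to a finite shift, and $\mathrm{span}(x)=\infty$ otherwise. Moreover, in every Sturmian shift space, the set of elements of span $1$ is countably infinite, and the set of elements of infinite span is uncountable. -/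

import Mathlib

namespace BiInfinite

/-- Bi-infinite words over the alphabet `A`; finite words are the elements of `List A`. -/
abbrev Word (A : Type*) := ℤ → A

/-- The finite word `x i, x (i+1), …, x (i+n-1)` of length `n`. -/
def block {A : Type*} (x : Word A) (i : ℤ) (n : ℕ) : List A :=
  List.ofFn fun j : Fin n => x (i + (j : ℕ))

/-- `w` is a factor of `x`, i.e. it has an occurrence in `x`. -/
def IsFactor {A : Type*} (x : Word A) (w : List A) : Prop :=
  ∃ i : ℤ, block x i w.length = w

/-- The factor complexity: the number of factors of length `n`. -/
noncomputable def complexity {A : Type*} (x : Word A) (n : ℕ) : ℕ :=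
  {w : List A | IsFactor x w ∧ w.length = n}.ncard

def IsLeftSpecial {A : Type*} (x : Word A) (u : List A) : Prop :=
  ∃ a b : A, a ≠ b ∧ IsFactor x (a :: u) ∧ IsFactor x (b :: u)

def IsRightSpecial {A : Type*} (x : Word A) (u : List A) : Prop :=
  ∃ a b : A, a ≠ b ∧ IsFactor x (u ++ [a]) ∧ IsFactor x (u ++ [b])

def PositivelyPeriodic {A : Type*} (x : Word A) : Prop :=
  ∃ (N : ℤ) (p : ℕ), 0 < p ∧ ∀ n : ℤ, N ≤ n → x n = x (n + p)

def NegativelyPeriodic {A : Type*} (x : Word A) : Prop :=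
  ∃ (N : ℤ) (p : ℕ), 0 < p ∧ ∀ n : ℤ, n ≤ N → x n = x (n - p)

/-- Neither positively nor negatively periodic. -/
def Aperiodic {A : Type*} (x : Word A) : Prop :=
  ¬ (PositivelyPeriodic x ∨ NegativelyPeriodic x)

/-- The `k`-th power of the shift map, `k ∈ ℤ`. -/
def shift {A : Type*} (k : ℤ) (x : Word A) : Word A := fun i => x (i + k)

/-- The closure of `{S^k x | k ∈ ℤ}` in the product topology (`A` is meant to be discrete). -/
def orbitClosure {A : Type*} [TopologicalSpace A] (x : Word A) : Set (Word A) :=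
  closure (Set.range fun k : ℤ => shift k x)

/-- Some occurrence of `w` in `x` crosses a position of `Γ`. -/
def IsCovered {A : Type*} (x : Word A) (Γ : Set ℤ) (w : List A) : Prop :=
  ∃ i : ℤ, block x i w.length = w ∧ (Set.Ico i (i + w.length) ∩ Γ).Nonempty

def IsStringAttractor {A : Type*} (x : Word A) (Γ : Set ℤ) : Prop :=
  ∀ w : List A, w ≠ [] → IsFactor x w → IsCovered x Γ w

/-- `sup Γ - inf Γ`, which is `⊤` when the nonempty set `Γ` is infinite.
(String attractors are never empty.) -/
noncomputable def setSpan (Γ : Set ℤ) : EReal :=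
  (⨆ a ∈ Γ, ((a : ℝ) : EReal)) - (⨅ a ∈ Γ, ((a : ℝ) : EReal))

/-- The string attractor span of a bi-infinite word. -/
noncomputable def span {A : Type*} (x : Word A) : EReal :=
  ⨅ Γ ∈ {Γ : Set ℤ | IsStringAttractor x Γ}, setSpan Γ

/-- Sturmian words over the binary alphabet `{0, 1}`. -/
def IsSturmian (x : Word (Fin 2)) : Prop :=
  (∀ n : ℕ, complexity x n = n + 1) ∧ Aperiodic x

/-- The words `x` whose letters at positions `-n, …, n+1` spell `r_n(x) c d l_n(x)` for all `n`.
A Sturmian word has exactly one right-special factor `r_n(x)` and exactly one left-special factor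
`l_n(x)` of each length `n`. -/
def HasSpecialCentre (x : Word (Fin 2)) (c d : Fin 2) : Prop :=
  ∀ n : ℕ, ∃ r l : List (Fin 2),
    (IsRightSpecial x r ∧ r.length = n) ∧ (IsLeftSpecial x l ∧ l.length = n) ∧
      block x (-(n : ℤ)) (2 * n + 2) = r ++ [c, d] ++ l

def IsUpperCharacteristic (x : Word (Fin 2)) : Prop :=
  IsSturmian x ∧ HasSpecialCentre x 0 1

def IsLowerCharacteristic (x : Word (Fin 2)) : Prop :=
  IsSturmian x ∧ HasSpecialCentre x 1 0

def IsCharacteristic (x : Word (Fin 2)) : Prop :=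
  IsUpperCharacteristic x ∨ IsLowerCharacteristic x

/-- `x` is, up to finite shift, characteristic. -/
def IsCharacteristicUpToShift (x : Word (Fin 2)) : Prop :=
  ∃ k : ℤ, IsCharacteristic (shift k x)

/-- A Sturmian shift space is the orbit closure of a Sturmian word. -/
def IsSturmianShift (X : Set (Word (Fin 2))) : Prop :=
  ∃ x : Word (Fin 2), IsSturmian x ∧ X = orbitClosure x

end BiInfinite

/-!
A Sturmian word `x` has exactly one right-special and one left-special factor of each length `n`,
because the two truncation maps from its `n + 2` factors of length `n + 1` to its `n + 1` factors
of length `n` are onto.  Everything is derived from this determinism: between two occurrences of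
the right-special factor `r` of length `n`, each block determines the next letter.

* Since `x` is not eventually periodic, `r` ends in each window of `n + 1` consecutive places
  (`exists_rightSpecialAt_mem`).  Hence long right-special factors have no small period
  (`exists_forall_not_period`), their occurrences are far apart, and `x` is uniformly recurrent
  (`exists_forall_block_eq`).  In particular, all elements of a Sturmian shift space are Sturmian
  with the same factors.

* If all blocks that end before position `0` are right-special, then `x` is characteristic
  (`isCharacteristic_of_rightSpecialAt`): there are bispecial factors `u` of arbitrary length that
  end before `0` such that `x` follows, from there on, the two return loops of `u` in turn.  The
  loops visit every factor of length `|u| + 1` exactly once, so they bring `x` back to `u` after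
  `|u| + 2` steps, that is, with `u` starting at position `2`.

* If `x` is characteristic, then the `n + 1` blocks of length `n` that meet `{0, 1}` are distinct
  (`injOn_block_of_special`), so they are all the factors, and `{0, 1}` is a string attractor.  No
  attractor of a word with two letters has span `0`.

* Let conversely `x` have a bounded string attractor in `[a, b]`.  Among the `n + (b - a)` blocks
  of length `n` that meet `[a, b]`, only `b - a - 1` are superfluous.  Both prolongations of the
  right-special factor must occur near `[a, b]`; unless the first of the two occurrences ends just
  before a position in `[a, b]`, going back from them produces too many coincidences or a
  bispecial factor of length between `n` and `n + (b - a)`.  The latter does not exist if `n - 1`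
  is the length of a long bispecial factor.  So, for infinitely many `n`, the right-special factor of length `n` ends
  at one of finitely many places, and the previous criterion applies
  (`exists_forall_rightSpecialAt`).

* In a Sturmian shift space, a word with all blocks before `0` right-special exists by
  compactness, its shifts are distinct, and a characteristic word is determined by its two
  central letters.  Finally, the space is compact without isolated points, by uniform recurrence,
  so it is uncountable by Baire's theorem.
-/

namespace BiInfinite

variable {A : Type*} {x y : Word A}

/-! ### Blocks and special factors -/

theorem block_eq_iff {i j : ℤ} {n : ℕ} :
    block x i n = block y j n ↔ ∀ k : ℕ, k < n → x (i + k) = y (j + k) := by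
  unfold block
  rw [List.ofFn_inj, funext_iff]
  exact ⟨fun h k hk => h ⟨k, hk⟩, fun h k => h k k.2⟩

theorem block_apply_eq {i j : ℤ} {n : ℕ} (h : block x i n = block y j n) (t : ℤ)
    (h0 : 0 ≤ t) (hn : t < n) : x (i + t) = y (j + t) := by
  have := block_eq_iff.1 h t.toNat (by omega)
  rwa [Int.toNat_of_nonneg h0] at this

theorem block_eq_of_forall {i j : ℤ} {n : ℕ}
    (h : ∀ t : ℤ, 0 ≤ t → t < n → x (i + t) = y (j + t)) : block x i n = block y j n :=
  block_eq_iff.2 fun k hk => h k (by omega) (by omega)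

/-- Equal blocks have equal sub-blocks in corresponding places. -/
theorem block_eq_sub {i j i' j' : ℤ} {n m : ℕ} (h : block x i n = block y j n)
    (hd : i' - i = j' - j) (h0 : i ≤ i') (hm : i' + m ≤ i + n) :
    block x i' m = block y j' m := by
  refine block_eq_of_forall fun t ht0 ht => ?_
  have := block_apply_eq h (i' - i + t) (by omega) (by omega)
  rwa [show i + (i' - i + t) = i' + t by ring, show j + (i' - i + t) = j' + t by rw [hd]; ring]
    at this

/-- Equal blocks may be prolonged to the right by equal letters. -/
theorem block_eq_snoc {i j : ℤ} {n : ℕ} (h : block x i n = block y j n)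
    (hx : x (i + n) = y (j + n)) : block x i (n + 1) = block y j (n + 1) := by
  refine block_eq_of_forall fun t ht0 ht => ?_
  rcases eq_or_ne t n with rfl | hne
  · exact hx
  · exact block_apply_eq h t ht0 (by omega)

/-- Equal blocks may be prolonged to the left by equal letters. -/
theorem block_eq_cons {i j : ℤ} {n : ℕ} (h : block x i n = block y j n)
    (hx : x (i - 1) = y (j - 1)) : block x (i - 1) (n + 1) = block y (j - 1) (n + 1) := by
  refine block_eq_of_forall fun t ht0 ht => ?_
  rcases eq_or_ne t 0 with rfl | hne
  · simpa using hx
  · have := block_apply_eq h (t - 1) (by omega) (by omega)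
    rwa [show i + (t - 1) = i - 1 + t by ring, show j + (t - 1) = j - 1 + t by ring] at this

@[simp] theorem length_block (x : Word A) (i : ℤ) (n : ℕ) : (block x i n).length = n := by
  simp [block]

theorem block_add (x : Word A) (i : ℤ) (m n : ℕ) :
    block x i (m + n) = block x i m ++ block x (i + m) n := by
  unfold block
  rw [List.ofFn_add]
  simp [add_assoc]

theorem block_one (x : Word A) (i : ℤ) : block x i 1 = [x i] := by simp [block]

theorem block_shift (x : Word A) (k i : ℤ) (n : ℕ) : block (shift k x) i n = block x (i + k) n :=
  block_eq_of_forall fun t _ _ => by simp only [shift]; congr 1; ring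

theorem setOf_isFactor_eq_range (x : Word A) (n : ℕ) :
    {w : List A | IsFactor x w ∧ w.length = n} = Set.range fun i => block x i n := by
  ext w
  constructor
  · rintro ⟨⟨i, hi⟩, rfl⟩
    exact ⟨i, hi⟩
  · rintro ⟨i, rfl⟩
    exact ⟨⟨i, by rw [length_block]⟩, length_block x i n⟩

/-- The block `x (e-n), …, x (e-1)` of length `n` that ends just before position `e` is
right-special: the same block also occurs before some `e'` that carries another letter. -/
def RightSpecialAt (x : Word A) (n : ℕ) (e : ℤ) : Prop :=
  ∃ e' : ℤ, block x (e' - n) n = block x (e - n) n ∧ x e' ≠ x e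

/-- The block `x s, …, x (s+n-1)` of length `n` that starts at position `s` is left-special. -/
def LeftSpecialAt (x : Word A) (n : ℕ) (s : ℤ) : Prop :=
  ∃ s' : ℤ, block x s' n = block x s n ∧ x (s' - 1) ≠ x (s - 1)

theorem RightSpecialAt.mono {n m : ℕ} {e : ℤ} (h : RightSpecialAt x n e) (hm : m ≤ n) :
    RightSpecialAt x m e := by
  obtain ⟨e', h1, h2⟩ := h
  exact ⟨e', block_eq_sub h1 (by ring) (by omega) (by omega), h2⟩

theorem LeftSpecialAt.mono {n m : ℕ} {s : ℤ} (h : LeftSpecialAt x n s) (hm : m ≤ n) :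
    LeftSpecialAt x m s := by
  obtain ⟨s', h1, h2⟩ := h
  exact ⟨s', block_eq_sub h1 (by ring) (by omega) (by omega), h2⟩

theorem RightSpecialAt.congr {n : ℕ} {e f : ℤ} (h : RightSpecialAt x n e)
    (hb : block x (f - n) n = block x (e - n) n) : RightSpecialAt x n f := by
  obtain ⟨e', h1, h2⟩ := h
  by_cases hf : x e' = x f
  · exact ⟨e, hb.symm, fun h => h2 (hf.trans h.symm)⟩
  · exact ⟨e', h1.trans hb.symm, hf⟩

theorem LeftSpecialAt.congr {n : ℕ} {s t : ℤ} (h : LeftSpecialAt x n s)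
    (hb : block x t n = block x s n) : LeftSpecialAt x n t := by
  obtain ⟨s', h1, h2⟩ := h
  by_cases hf : x (s' - 1) = x (t - 1)
  · exact ⟨s, hb.symm, fun h => h2 (hf.trans h.symm)⟩
  · exact ⟨s', h1.trans hb.symm, hf⟩

/-- A block that is not right-special determines the letter after it. -/
theorem apply_eq_of_not_rightSpecialAt {n : ℕ} {e f : ℤ} (h : ¬ RightSpecialAt x n e)
    (hb : block x (f - n) n = block x (e - n) n) : x f = x e := by
  by_contra hne
  exact h ⟨f, hb, hne⟩

theorem block_succ_end {n : ℕ} {e f : ℤ} (hb : block x (f - n) n = block x (e - n) n)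
    (hx : x f = x e) : block x (f - n) (n + 1) = block x (e - n) (n + 1) :=
  block_eq_snoc hb (by simpa using hx)

/-- If a block returns without any right-special block in between, then the word is
deterministic from there on. -/
theorem positivelyPeriodic_of_return {n : ℕ} {i j : ℤ} (hij : i < j)
    (hb : block x (j - n) n = block x (i - n) n)
    (hs : ∀ e, i ≤ e → e < j → ¬ RightSpecialAt x n e) : PositivelyPeriodic x := by
  have key : ∀ t : ℕ, block x (j + t - n) n = block x (i + t - n) n ∧
      ¬ RightSpecialAt x n (i + t) := by
    intro t
    induction t using Nat.strong_induction_on with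
    | _ t ih =>
      have h1 : block x (j + t - n) n = block x (i + t - n) n := by
        rcases t with _ | t
        · simpa using hb
        · obtain ⟨h, hn⟩ := ih t (by omega)
          have := block_succ_end h (apply_eq_of_not_rightSpecialAt hn h)
          exact block_eq_sub this (by push_cast; ring) (by push_cast; omega) (by push_cast; omega)
      refine ⟨h1, ?_⟩
      by_cases ht : i + t < j
      · exact hs _ (by omega) ht
      · intro hr
        obtain ⟨h, hn⟩ := ih (t - (j - i).toNat) (by omega)
        refine hn (hr.congr ?_)
        rw [show j + ((t - (j - i).toNat : ℕ) : ℤ) = i + t by omega] at h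
        exact h.symm
  refine ⟨i, (j - i).toNat, by omega, fun m hm => ?_⟩
  obtain ⟨h, hn⟩ := key (m - i).toNat
  have := apply_eq_of_not_rightSpecialAt hn h
  rw [show i + ((m - i).toNat : ℤ) = m by omega] at this
  rw [← this]
  congr 1
  omega

/-! ### Uniqueness of special factors -/

/-- If a set has one element more than its image, then only one fibre has more than one element. -/
theorem eq_of_ncard_image_add_one {α β : Type*} {S : Set α} (f : α → β)
    (hS : S.Finite) (hc : S.ncard = (f '' S).ncard + 1) {a a' b b' : α} (ha : a ∈ S) (ha' : a' ∈ S)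
    (hb : b ∈ S) (hb' : b' ∈ S) (haa : a ≠ a') (hbb : b ≠ b') (hfa : f a = f a')
    (hfb : f b = f b') : f a = f b := by
  by_contra hne
  have hab : a ≠ b := fun h => hne (by rw [h])
  have hsub : f '' S ⊆ f '' (S \ {a, b}) := by
    rintro _ ⟨c, hcS, rfl⟩
    by_cases hca : c = a
    · refine ⟨a', ⟨ha', ?_⟩, by rw [hca, hfa]⟩
      rintro (h | h)
      · exact haa h.symm
      · exact hne (by rw [hfa]; exact congrArg f h)
    by_cases hcb : c = b
    · refine ⟨b', ⟨hb', ?_⟩, by rw [hcb, hfb]⟩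
      rintro (h | h)
      · exact hne (by rw [hfb]; exact (congrArg f h).symm)
      · exact hbb h.symm
    exact ⟨c, ⟨hcS, by simp [hca, hcb]⟩, rfl⟩
  have h1 := Set.ncard_le_ncard hsub ((hS.sdiff).image f)
  have h2 := Set.ncard_image_le (f := f) (hS.sdiff (t := {a, b}))
  have h3 : (S \ {a, b}).ncard + ({a, b} : Set α).ncard = S.ncard :=
    Set.ncard_sdiff_add_ncard_of_subset (by rintro _ (rfl | rfl) <;> assumption) hS
  rw [Set.ncard_pair hab] at h3
  omega

theorem image_dropLast_range (x : Word A) (n : ℕ) :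
    List.dropLast '' (Set.range fun i => block x i (n + 1)) = Set.range fun i => block x i n := by
  rw [← Set.range_comp]
  congr 1
  ext1 i
  simp [block_add, block_one]

theorem image_tail_range (x : Word A) (n : ℕ) :
    List.tail '' (Set.range fun i => block x i (n + 1)) = Set.range fun i => block x i n := by
  rw [← Set.range_comp]
  have : (List.tail ∘ fun i => block x i (n + 1)) = fun i => block x (i + 1) n := by
    ext1 i
    simp [add_comm n 1, block_add, block_one]
  rw [this]
  exact (Equiv.addRight (1 : ℤ)).surjective.range_comp fun i => block x i n

theorem eq_of_ne_of_ne {a b c : Fin 2} (ha : a ≠ c) (hb : b ≠ c) : a = b := by omega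

namespace IsSturmian

variable {x : Word (Fin 2)}

theorem ncard_range_block (hx : IsSturmian x) (n : ℕ) :
    (Set.range fun i => block x i n).ncard = n + 1 := by
  rw [← setOf_isFactor_eq_range]
  exact hx.1 n

theorem finite_range_block (hx : IsSturmian x) (n : ℕ) :
    (Set.range fun i => block x i n).Finite :=
  Set.finite_of_ncard_pos (by rw [hx.ncard_range_block]; omega)

/-- There is at most one right-special factor of each length. -/
theorem rightSpecialAt_unique (hx : IsSturmian x) {n : ℕ} {e f : ℤ} (he : RightSpecialAt x n e)
    (hf : RightSpecialAt x n f) : block x (e - n) n = block x (f - n) n := by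
  obtain ⟨e', he1, he2⟩ := he
  obtain ⟨f', hf1, hf2⟩ := hf
  have hd : ∀ i, (block x (i - n) (n + 1)).dropLast = block x (i - n) n := fun i => by
    simp [block_add, block_one]
  have hn : ∀ i j, x i ≠ x j → block x (i - n) (n + 1) ≠ block x (j - n) (n + 1) := by
    intro i j hij h
    have := block_apply_eq h n (by omega) (by omega)
    simp at this
    exact hij this
  have := eq_of_ncard_image_add_one List.dropLast (hx.finite_range_block (n + 1))
    (by rw [image_dropLast_range, hx.ncard_range_block, hx.ncard_range_block])
    (a := block x (e - n) (n + 1)) (a' := block x (e' - n) (n + 1))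
    (b := block x (f - n) (n + 1)) (b' := block x (f' - n) (n + 1))
    ⟨e - n, rfl⟩ ⟨e' - n, rfl⟩ ⟨f - n, rfl⟩ ⟨f' - n, rfl⟩ (hn _ _ he2.symm) (hn _ _ hf2.symm)
    (by rw [hd, hd, he1]) (by rw [hd, hd, hf1])
  rwa [hd, hd] at this

/-- There is at most one left-special factor of each length. -/
theorem leftSpecialAt_unique (hx : IsSturmian x) {n : ℕ} {s t : ℤ} (hs : LeftSpecialAt x n s)
    (ht : LeftSpecialAt x n t) : block x s n = block x t n := by
  obtain ⟨s', hs1, hs2⟩ := hs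
  obtain ⟨t', ht1, ht2⟩ := ht
  have hd : ∀ i, (block x (i - 1) (n + 1)).tail = block x i n := fun i => by
    simp [add_comm n 1, block_add, block_one]
  have hn : ∀ i j, x (i - 1) ≠ x (j - 1) → block x (i - 1) (n + 1) ≠ block x (j - 1) (n + 1) := by
    intro i j hij h
    have := block_apply_eq h 0 (by omega) (by omega)
    simp at this
    exact hij this
  have := eq_of_ncard_image_add_one List.tail (hx.finite_range_block (n + 1))
    (by rw [image_tail_range, hx.ncard_range_block, hx.ncard_range_block])
    (a := block x (s - 1) (n + 1)) (a' := block x (s' - 1) (n + 1))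
    (b := block x (t - 1) (n + 1)) (b' := block x (t' - 1) (n + 1))
    ⟨s - 1, rfl⟩ ⟨s' - 1, rfl⟩ ⟨t - 1, rfl⟩ ⟨t' - 1, rfl⟩ (hn _ _ hs2.symm) (hn _ _ ht2.symm)
    (by rw [hd, hd, hs1]) (by rw [hd, hd, ht1])
  rwa [hd, hd] at this

theorem exists_rightSpecialAt (hx : IsSturmian x) (n : ℕ) : ∃ e, RightSpecialAt x n e := by
  by_contra! h
  have hinj : Set.InjOn List.dropLast (Set.range fun i => block x i (n + 1)) := by
    rintro _ ⟨i, rfl⟩ _ ⟨j, rfl⟩ hij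
    simp only [block_add, block_one, List.dropLast_concat] at hij
    have hij' : block x (i + n - n) n = block x (j + n - n) n := by simpa using hij
    exact block_eq_snoc hij (apply_eq_of_not_rightSpecialAt (h (j + n)) hij')
  have := hinj.ncard_image
  rw [image_dropLast_range, hx.ncard_range_block, hx.ncard_range_block] at this
  omega

/-! ### Return times and uniform recurrence -/

/-- The right-special factor of length `n` ends in every window of `n + 1` consecutive places. -/
theorem exists_rightSpecialAt_mem (hx : IsSturmian x) (n : ℕ) (i : ℤ) :
    ∃ e, i ≤ e ∧ e ≤ i + n ∧ RightSpecialAt x n e := by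
  by_contra! h
  obtain ⟨e₀, he₀⟩ := hx.exists_rightSpecialAt n
  obtain ⟨j, hj, k, hk, hjk, heq⟩ := Set.exists_ne_map_eq_of_ncard_lt_of_maps_to
    (s := Set.Icc i (i + n)) (t := (Set.range fun i => block x i n) \ {block x (e₀ - n) n})
    (by
      rw [Set.ncard_sdiff_singleton_of_mem (Set.mem_range_self (e₀ - (n : ℤ))), hx.ncard_range_block,
        ← Finset.coe_Icc, Set.ncard_coe_finset, Int.card_Icc]
      omega)
    (f := fun e => block x (e - n) n)
    (fun e he => ⟨⟨_, rfl⟩, fun hee => h e he.1 he.2 (he₀.congr hee)⟩)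
    ((hx.finite_range_block n).sdiff)
  simp only [Set.mem_Icc] at hj hk
  refine hx.2 (Or.inl ?_)
  rcases lt_or_gt_of_ne hjk with hlt | hlt
  · exact positivelyPeriodic_of_return hlt heq.symm fun e h1 h2 => h e (by omega) (by omega)
  · exact positivelyPeriodic_of_return hlt heq fun e h1 h2 => h e (by omega) (by omega)

theorem not_eventually_eq_sub (hx : IsSturmian x) {p : ℕ} (hp : 0 < p) (N : ℤ) :
    ∃ k, N ≤ k ∧ x k ≠ x (k - p) := by
  by_contra! h
  refine hx.2 (Or.inl ⟨N, p, hp, fun n hn => ?_⟩)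
  simpa using (h (n + p) (by omega)).symm

/-- Long right-special factors do not have the period `p`.  Otherwise, around a position `b` with
`x b ≠ x (b - p)`, an occurrence of the right-special factor of length `n` would have to start
in `[b - p + 1, b + 1]`, for each `n`, so that `x` would be periodic from `b + 1` on. -/
theorem exists_forall_not_period (hx : IsSturmian x) {p : ℕ} (hp : 0 < p) :
    ∃ n₀ : ℕ, ∀ n : ℕ, n₀ ≤ n → ∀ e, RightSpecialAt x n e →
      ∃ k, e - n + p ≤ k ∧ k < e ∧ x k ≠ x (k - p) := by
  by_contra! h
  obtain ⟨b, -, hb⟩ := hx.not_eventually_eq_sub hp 0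
  obtain ⟨k, hk, hxk⟩ := hx.not_eventually_eq_sub hp (b + 1 + p)
  obtain ⟨n, hn, e, he, hper⟩ := h (k - b + 2 * p).toNat
  obtain ⟨f, hf1, hf2, hf⟩ := hx.exists_rightSpecialAt_mem n (b + 1)
  have heq := hx.rightSpecialAt_unique hf he
  have hper' : ∀ k, f - n + p ≤ k → k < f → x k = x (k - p) := by
    intro k h1 h2
    have h3 := block_apply_eq heq (k - f + n) (by omega) (by omega)
    have h4 := block_apply_eq heq (k - f + n - p) (by omega) (by omega)
    have h5 := hper (e + (k - f)) (by omega) (by omega)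
    rw [show f - n + (k - f + n) = k by ring, show e - n + (k - f + n) = e + (k - f) by ring] at h3
    rw [show f - n + (k - f + n - p) = k - p by ring,
      show e - n + (k - f + n - p) = e + (k - f) - p by ring] at h4
    rw [h3, h4, h5]
  have hfb : b < f - n + p := by
    by_contra! hle
    exact hb (hper' b hle (by omega))
  exact hxk (hper' k (by omega) (by omega))

theorem exists_forall_not_period_le (hx : IsSturmian x) (D : ℕ) :
    ∃ n₀ : ℕ, ∀ n : ℕ, n₀ ≤ n → ∀ e, RightSpecialAt x n e → ∀ p : ℕ, 0 < p → p ≤ D →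
      ∃ k, e - n + p ≤ k ∧ k < e ∧ x k ≠ x (k - p) := by
  induction D with
  | zero => exact ⟨0, fun n _ e _ p h1 h2 => by omega⟩
  | succ D ih =>
    obtain ⟨a, ha⟩ := ih
    obtain ⟨b, hb⟩ := hx.exists_forall_not_period (Nat.succ_pos D)
    refine ⟨max a b, fun n hn e he p h1 h2 => ?_⟩
    rcases Nat.lt_or_ge D p with h | h
    · obtain rfl : p = D + 1 := by omega
      exact hb n (by omega) e he
    · exact ha n (by omega) e he p h1 h

/-- Two occurrences of a long right-special factor are far apart. -/
theorem exists_forall_lt_sub (hx : IsSturmian x) (D : ℕ) :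
    ∃ n₀ : ℕ, ∀ n : ℕ, n₀ ≤ n → ∀ e f, RightSpecialAt x n e → RightSpecialAt x n f → e < f →
      D < f - e := by
  obtain ⟨n₀, h⟩ := hx.exists_forall_not_period_le D
  refine ⟨n₀, fun n hn e f he hf hef => ?_⟩
  by_contra! hD
  obtain ⟨k, h1, h2, h3⟩ := h n hn f hf (f - e).toNat (by omega) (by omega)
  have := block_apply_eq (hx.rightSpecialAt_unique hf he) (k - f + n) (by omega) (by omega)
  rw [show f - n + (k - f + n) = k by ring] at this
  apply h3
  rw [this]
  congr 1
  omega

/-- Each of the two prolongations of the right-special factor of length `n` occurs in every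
sufficiently long window: otherwise, the window would be periodic with period at most `n + 1`. -/
theorem exists_rightSpecialAt_mem_apply_eq (hx : IsSturmian x) (n : ℕ) :
    ∃ M : ℕ, ∀ (i : ℤ) (c : Fin 2), ∃ e, i ≤ e ∧ e ≤ i + M ∧ RightSpecialAt x n e ∧ x e = c := by
  obtain ⟨N, hN⟩ := hx.exists_forall_not_period_le (n + 1)
  refine ⟨2 * n + 2 * N + 2, fun i c => ?_⟩
  by_contra! h
  push_cast at h
  obtain ⟨e₁, h11, h12, h1⟩ := hx.exists_rightSpecialAt_mem n i
  obtain ⟨e₂, h21, h22, h2⟩ := hx.exists_rightSpecialAt_mem n (e₁ + 1)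
  have key : ∀ t : ℕ, e₂ + t ≤ i + (2 * n + 2 * N + 2) →
      block x (e₂ + t - n) n = block x (e₁ + t - n) n ∧ x (e₂ + t) = x (e₁ + t) := by
    intro t
    induction t with
    | zero =>
      intro ht
      refine ⟨by simpa using hx.rightSpecialAt_unique h2 h1, ?_⟩
      simpa using eq_of_ne_of_ne (h e₂ (by omega) (by omega) h2) (h e₁ (by omega) (by omega) h1)
    | succ t ih =>
      intro ht
      push_cast at ht
      obtain ⟨h3, h4⟩ := ih (by omega)
      have h5 : block x (e₂ + (t + 1 : ℕ) - n) n = block x (e₁ + (t + 1 : ℕ) - n) n :=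
        block_eq_sub (block_succ_end h3 h4) (by push_cast; ring) (by push_cast; omega)
          (by push_cast; omega)
      refine ⟨h5, ?_⟩
      by_cases hr : RightSpecialAt x n (e₁ + (t + 1 : ℕ))
      · exact eq_of_ne_of_ne (h _ (by push_cast; omega) (by push_cast; omega) (hr.congr h5))
          (h _ (by push_cast; omega) (by push_cast; omega) hr)
      · exact apply_eq_of_not_rightSpecialAt hr h5
  obtain ⟨e, he1, he2, he⟩ := hx.exists_rightSpecialAt_mem N (e₂ + N)
  obtain ⟨k, hk1, hk2, hk⟩ := hN N le_rfl e he (e₂ - e₁).toNat (by omega) (by omega)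
  have := (key (k - e₂).toNat (by omega)).2
  apply hk
  rw [show e₂ + ((k - e₂).toNat : ℤ) = k by omega] at this
  rw [this]
  congr 1
  omega

/-- Sturmian words are uniformly recurrent. -/
theorem exists_forall_block_eq (hx : IsSturmian x) (n : ℕ) (j : ℤ) :
    ∃ M : ℕ, ∀ i : ℤ, ∃ k, i ≤ k ∧ k ≤ i + M ∧ block x k n = block x j n := by
  have hR : ∀ e, RightSpecialAt x n e →
      ∃ M : ℕ, ∀ i : ℤ, ∃ k, i ≤ k ∧ k ≤ i + M ∧ block x (k - n) n = block x (e - n) n :=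
    fun e he => ⟨n, fun i => (hx.exists_rightSpecialAt_mem n i).imp fun k hk =>
      ⟨hk.1, hk.2.1, hx.rightSpecialAt_unique hk.2.2 he⟩⟩
  obtain ⟨e, he1, he2, he⟩ := hx.exists_rightSpecialAt_mem n j
  have key : ∀ t : ℕ,
      ∃ M : ℕ, ∀ i : ℤ, ∃ k, i ≤ k ∧ k ≤ i + M ∧
        block x (k - n) n = block x (e + t - n) n := by
    intro t
    induction t with
    | zero => simpa using hR e he
    | succ t ih =>
      by_cases hr : RightSpecialAt x n (e + t)
      · obtain ⟨M, hM⟩ := hx.exists_rightSpecialAt_mem_apply_eq n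
        refine ⟨M + 1, fun i => ?_⟩
        obtain ⟨k, h1, h2, h3, h4⟩ := hM i (x (e + t))
        refine ⟨k + 1, by omega, by push_cast; omega, ?_⟩
        exact block_eq_sub (block_succ_end (hx.rightSpecialAt_unique h3 hr) h4)
          (by push_cast; ring) (by omega) (by push_cast; omega)
      · obtain ⟨M, hM⟩ := ih
        refine ⟨M + 1, fun i => ?_⟩
        obtain ⟨k, h1, h2, h3⟩ := hM i
        refine ⟨k + 1, by omega, by push_cast; omega, ?_⟩
        exact block_eq_sub (block_succ_end h3 (apply_eq_of_not_rightSpecialAt hr h3))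
          (by push_cast; ring) (by omega) (by push_cast; omega)
  obtain ⟨M, hM⟩ := key (j + n - e).toNat
  refine ⟨M, fun i => ?_⟩
  obtain ⟨k, h1, h2, h3⟩ := hM (i + n)
  refine ⟨k - n, by omega, by omega, ?_⟩
  rw [h3]
  congr 1
  omega

end IsSturmian

/-! ### Words with a special left half are characteristic -/

/-- The centre in terms of positions: the two half-words next to the central letters are
special. -/
theorem hasSpecialCentre_iff {x : Word (Fin 2)} {c d : Fin 2} :
    HasSpecialCentre x c d ↔ x 0 = c ∧ x 1 = d ∧
      ∀ n, RightSpecialAt x n 0 ∧ LeftSpecialAt x n 2 := by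
  have hdecomp : ∀ n : ℕ, block x (-(n : ℤ)) (2 * n + 2) =
      block x (0 - (n : ℤ)) n ++ [x 0, x 1] ++ block x 2 n := by
    intro n
    rw [show 2 * n + 2 = n + (1 + (1 + n)) by ring, block_add, block_add, block_add, block_one,
      block_one]
    simp [show (1 : ℤ) + 1 = 2 from rfl]
  have hR : ∀ n : ℕ, IsRightSpecial x (block x (0 - (n : ℤ)) n) ↔ RightSpecialAt x n 0 := by
    intro n
    have hf : ∀ a, IsFactor x (block x (0 - (n : ℤ)) n ++ [a]) ↔
        ∃ e, block x (e - n) n = block x (0 - (n : ℤ)) n ∧ x e = a := by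
      intro a
      simp only [IsFactor, List.length_append, length_block, List.length_singleton, block_add,
        block_one]
      constructor
      · rintro ⟨i, hi⟩
        have := List.append_inj hi (by simp)
        exact ⟨i + n, by simpa using this.1, by simpa using this.2⟩
      · rintro ⟨e, h1, h2⟩
        exact ⟨e - n, by simp [h1, h2]⟩
    constructor
    · rintro ⟨a, b, hab, ha, hb⟩
      obtain ⟨e, h1, h2⟩ := (hf a).1 ha
      obtain ⟨f, h3, h4⟩ := (hf b).1 hb
      by_cases h : x e = x 0
      · exact ⟨f, h3, fun h' => hab (by rw [← h2, ← h4, h, h'])⟩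
      · exact ⟨e, h1, h⟩
    · rintro ⟨e, h1, h2⟩
      exact ⟨x e, x 0, h2, (hf _).2 ⟨e, h1, rfl⟩, (hf _).2 ⟨0, rfl, rfl⟩⟩
  have hL : ∀ n : ℕ, IsLeftSpecial x (block x 2 n) ↔ LeftSpecialAt x n 2 := by
    intro n
    have hf : ∀ a, IsFactor x (a :: block x 2 n) ↔
        ∃ s, block x s n = block x 2 n ∧ x (s - 1) = a := by
      intro a
      simp only [IsFactor, List.length_cons, length_block, add_comm n 1, block_add,
        block_one]
      constructor
      · rintro ⟨i, hi⟩
        simp only [List.singleton_append, List.cons.injEq] at hi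
        exact ⟨i + 1, by simpa using hi.2, by simpa using hi.1⟩
      · rintro ⟨e, h1, h2⟩
        exact ⟨e - 1, by simp [h1, h2]⟩
    constructor
    · rintro ⟨a, b, hab, ha, hb⟩
      obtain ⟨e, h1, h2⟩ := (hf a).1 ha
      obtain ⟨f, h3, h4⟩ := (hf b).1 hb
      by_cases h : x (e - 1) = x (2 - 1)
      · exact ⟨f, h3, fun h' => hab (by rw [← h2, ← h4, h, h'])⟩
      · exact ⟨e, h1, h⟩
    · rintro ⟨e, h1, h2⟩
      exact ⟨x (e - 1), x (2 - 1), h2, (hf _).2 ⟨e, h1, rfl⟩, (hf _).2 ⟨2, rfl, rfl⟩⟩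
  constructor
  · intro h
    have h' : ∀ n : ℕ, x 0 = c ∧ x 1 = d ∧ RightSpecialAt x n 0 ∧ LeftSpecialAt x n 2 := by
      intro n
      obtain ⟨r, l, ⟨hr, hrn⟩, ⟨hl, hln⟩, heq⟩ := h n
      rw [hdecomp] at heq
      obtain ⟨h1, h2⟩ := List.append_inj heq (by simp [hrn])
      obtain ⟨h3, h4⟩ := List.append_inj h1 (by simp [hrn])
      subst h2 h3
      simp only [List.cons.injEq, and_true] at h4
      exact ⟨h4.1, h4.2, (hR n).1 hr, (hL n).1 hl⟩
    exact ⟨(h' 0).1, (h' 0).2.1, fun n => (h' n).2.2⟩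
  · rintro ⟨rfl, rfl, h⟩ n
    exact ⟨_, _, ⟨(hR n).2 (h n).1, length_block _ _ _⟩, ⟨(hL n).2 (h n).2, length_block _ _ _⟩,
      hdecomp n⟩

namespace IsSturmian

variable {x : Word (Fin 2)}

theorem not_forall_eq_of_ge (hx : IsSturmian x) (c : Fin 2) (N : ℤ) :
    ∃ k, N ≤ k ∧ x k ≠ c := by
  obtain ⟨k, hk, hne⟩ := hx.not_eventually_eq_sub one_pos (N + 1)
  by_cases h : x k = c
  · exact ⟨k - 1, by omega, fun h' => hne (by push_cast; rw [h, h'])⟩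
  · exact ⟨k, by omega, h⟩

theorem not_forall_eq_of_le (hx : IsSturmian x) (c : Fin 2) (N : ℤ) :
    ∃ k, k ≤ N ∧ x k ≠ c := by
  by_contra! h
  exact hx.2 (Or.inr ⟨N, 1, one_pos, fun n hn => by rw [h n hn, h (n - _) (by push_cast; omega)]⟩)

/-- Between the two infinite special halves, the letters differ: otherwise one would find, by
induction, that `x` is constant around the centre. -/
theorem apply_zero_ne_apply_one (hx : IsSturmian x) (hR : ∀ n, RightSpecialAt x n 0)
    (hL : ∀ n, LeftSpecialAt x n 2) : x 0 ≠ x 1 := by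
  intro h01
  have key : ∀ n : ℕ, ∀ i : ℤ, -(n : ℤ) ≤ i → i ≤ n + 1 → x i = x 0 := by
    intro n
    induction n with
    | zero =>
      intro i h1 h2
      obtain rfl | rfl : i = 0 ∨ i = 1 := by push_cast at *; omega
      · rfl
      · exact h01.symm
    | succ n ih =>
      have hl : x (-(n + 1 : ℤ)) = x 0 := by
        obtain ⟨k, hk, hkne⟩ := hx.not_forall_eq_of_ge (x 0) 1
        have hex : ∃ t : ℕ, x (1 + t) ≠ x 0 :=
          ⟨(k - 1).toNat, by rwa [show 1 + ((k - 1).toNat : ℤ) = k by omega]⟩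
        classical
        set t := Nat.find hex with ht
        have hall : ∀ i : ℤ, -(n : ℤ) ≤ i → i < 1 + t → x i = x 0 := by
          intro i h1 h2
          rcases le_or_gt i (n + 1) with h | h
          · exact ih i h1 h
          · have := Nat.find_min hex (m := (i - 1).toNat) (by omega)
            rw [show 1 + ((i - 1).toNat : ℤ) = i by omega] at this
            exact not_not.1 this
        have hs : RightSpecialAt x (n + 1) (1 + t) := by
          refine ⟨1, block_eq_of_forall fun s h1 h2 => ?_, ?_⟩
          · exact (hall _ (by omega) (by omega)).trans (hall _ (by omega) (by omega)).symm
          · rw [← h01]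
            exact (Nat.find_spec hex).symm
        have := block_apply_eq (hx.rightSpecialAt_unique (hR (n + 1)) hs) 0 le_rfl (by omega)
        rw [hall (1 + t - (n + 1 : ℕ) + 0) (by push_cast; omega) (by push_cast; omega)] at this
        rw [← this]
        congr 1
      have hr : x (n + 2 : ℤ) = x 0 := by
        obtain ⟨k, hk, hkne⟩ := hx.not_forall_eq_of_le (x 0) 0
        have hex : ∃ t : ℕ, x (-t) ≠ x 0 :=
          ⟨(-k).toNat, by rwa [show -((-k).toNat : ℤ) = k by omega]⟩
        classical
        set t := Nat.find hex with ht
        have hall : ∀ i : ℤ, -(t : ℤ) < i → i ≤ n + 1 → x i = x 0 := by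
          intro i h1 h2
          rcases le_or_gt (-(n : ℤ)) i with h | h
          · exact ih i h h2
          · have := Nat.find_min hex (m := (-i).toNat) (by omega)
            rw [show -((-i).toNat : ℤ) = i by omega] at this
            exact not_not.1 this
        have hs : LeftSpecialAt x (n + 1) (-t + 1) := by
          refine ⟨1, block_eq_of_forall fun s h1 h2 => ?_, ?_⟩
          · exact (hall _ (by omega) (by omega)).trans (hall _ (by omega) (by omega)).symm
          · simpa using (Nat.find_spec hex).symm
        have := block_apply_eq (hx.leftSpecialAt_unique (hL (n + 1)) hs) n (by omega) (by omega)
        rw [hall (-t + 1 + n) (by omega) (by omega)] at this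
        rw [← this]
        congr 1
        ring
      intro i h1 h2
      push_cast at h1 h2
      rcases eq_or_ne i (-(n + 1 : ℤ)) with rfl | h3
      · exact hl
      rcases eq_or_ne i (n + 2 : ℤ) with rfl | h4
      · exact hr
      exact ih i (by omega) (by omega)
  obtain ⟨k, hk, hne⟩ := hx.not_forall_eq_of_ge (x 0) 0
  exact hne (key k.toNat k (by omega) (by omega))

/-- Two occurrences of a block have a longest common extension to the left, as `x` is not
negatively periodic.  If the letters after them differ, this extension is bispecial. -/
theorem exists_longest_left_agreement (hx : IsSturmian x) {n : ℕ} {e f : ℤ} (hef : e < f)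
    (hb : block x (f - n) n = block x (e - n) n) :
    ∃ k : ℕ, n ≤ k ∧ block x (f - k) k = block x (e - k) k ∧ x (f - k - 1) ≠ x (e - k - 1) := by
  have hex : ∃ k : ℕ, block x (f - (k + 1 : ℕ)) (k + 1) ≠ block x (e - (k + 1 : ℕ)) (k + 1) := by
    by_contra! h
    refine hx.2 (Or.inr ⟨f - 1, (f - e).toNat, by omega, fun m hm => ?_⟩)
    have := block_apply_eq (h (f - 1 - m).toNat) 0 le_rfl (by push_cast; omega)
    rw [show f - ((f - 1 - m).toNat + 1 : ℕ) + 0 = m by push_cast; omega] at this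
    rw [this]
    congr 1
    push_cast
    omega
  classical
  refine ⟨Nat.find hex, ?_⟩
  have hspec := Nat.find_spec hex
  have hmin : ∀ m < Nat.find hex, _ := fun m hm => not_not.1 (Nat.find_min hex hm)
  generalize Nat.find hex = k at *
  have hk : block x (f - k) k = block x (e - k) k := by
    rcases k with _ | k
    · simp [block]
    · exact hmin k (by omega)
  refine ⟨?_, hk, fun h => hspec ?_⟩
  · by_contra! hlt
    exact hspec (block_eq_sub hb (by ring) (by omega) (by omega))
  · have := block_eq_cons hk h
    rwa [sub_sub, sub_sub] at this

/-- If all blocks that end just before position `0` are right-special, then so are, on the left,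
those that start at position `2`.  Let `p` be the first return of a right-special factor after
position `0`; the longest common left extension `u`, of length `k`, of the two occurrences is
bispecial, and the two return loops of `u`, of lengths `p` and `q`, are followed in turn.  They
visit each factor of length `k + 1` once, whence `p + q = k + 2` and `u` starts at position `2`. -/
theorem leftSpecialAt_two (hx : IsSturmian x) (hR : ∀ n, RightSpecialAt x n 0) (N : ℕ) :
    LeftSpecialAt x N 2 := by
  classical
  have hexp : ∃ p : ℕ, 0 < p ∧ RightSpecialAt x N p := by
    obtain ⟨e, h1, h2, he⟩ := hx.exists_rightSpecialAt_mem N 1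
    exact ⟨e.toNat, by omega, by rwa [Int.toNat_of_nonneg (by omega)]⟩
  obtain ⟨p, ⟨hp0, hp⟩, hpmin⟩ : ∃ p : ℕ, (0 < p ∧ RightSpecialAt x N p) ∧
      ∀ t : ℕ, 0 < t → t < p → ¬ RightSpecialAt x N t :=
    ⟨Nat.find hexp, Nat.find_spec hexp, fun t h0 ht h => Nat.find_min hexp ht ⟨h0, h⟩⟩
  obtain ⟨k, hNk, hbk, hxk⟩ := hx.exists_longest_left_agreement (e := 0) (f := p) (by omega)
    (hx.rightSpecialAt_unique hp (hR N))
  have hLk : LeftSpecialAt x k (0 - k) := ⟨_, hbk, hxk⟩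
  have hp' : ∀ e : ℤ, 0 < e → e < p → ¬ RightSpecialAt x k e := by
    intro e h0 h1 h
    refine hpmin e.toNat (by omega) (by omega) ?_
    rw [Int.toNat_of_nonneg h0.le]
    exact h.mono hNk
  have hp1 : ¬ RightSpecialAt x (k + 1) p := by
    intro h
    have := block_apply_eq (hx.rightSpecialAt_unique h (hR (k + 1))) 0 le_rfl (by omega)
    simp only [Nat.cast_add, Nat.cast_one, add_zero, ← sub_sub] at this
    exact hxk this
  -- If the first loop were followed twice in a row, it would be followed forever.
  have hxp : x p ≠ x 0 := by
    intro h
    have hb1 := block_succ_end hbk h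
    refine hx.2 (Or.inl (positivelyPeriodic_of_return (n := k + 1) (i := 1) (j := p + 1) (by omega)
      ?_ fun e h1 h2 => ?_))
    · rw [show (p : ℤ) + 1 - (k + 1 : ℕ) = p - k by push_cast; ring,
        show (1 : ℤ) - (k + 1 : ℕ) = 0 - k by push_cast; ring]
      exact hb1
    · rcases eq_or_ne e p with rfl | hne
      · exact hp1
      · exact fun h => hp' e (by omega) (by omega) (h.mono (by omega))
  have hexq : ∃ q : ℕ, 0 < q ∧ RightSpecialAt x k (p + q) := by
    obtain ⟨e, h1, h2, he⟩ := hx.exists_rightSpecialAt_mem k (p + 1)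
    exact ⟨(e - p).toNat, by omega, by rwa [show (p : ℤ) + ((e - p).toNat : ℤ) = e by omega]⟩
  obtain ⟨q, ⟨hq0, hq⟩, hqmin⟩ : ∃ q : ℕ, (0 < q ∧ RightSpecialAt x k (p + q)) ∧
      ∀ t : ℕ, 0 < t → t < q → ¬ RightSpecialAt x k (p + t) :=
    ⟨Nat.find hexq, Nat.find_spec hexq, fun t h0 ht h => Nat.find_min hexq ht ⟨h0, h⟩⟩
  have hq' : ∀ e : ℤ, p < e → e < p + q → ¬ RightSpecialAt x k e := by
    intro e h0 h1 h
    refine hqmin (e - p).toNat (by omega) (by omega) ?_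
    rwa [show (p : ℤ) + ((e - p).toNat : ℤ) = e by omega]
  -- `E e` is the block of length `k + 1` that ends with the letter at position `e`.
  let E : ℤ → List (Fin 2) := fun e => block x (e - k) (k + 1)
  have hsurj : ∀ e, ∃ e' : ℤ, 0 ≤ e' ∧ e' < p + q ∧ E e = E e' := by
    have base : ∀ e, RightSpecialAt x k e → ∃ e' : ℤ, 0 ≤ e' ∧ e' < p + q ∧ E e = E e' := by
      intro e he
      have h0 := hx.rightSpecialAt_unique he (hR k)
      by_cases h : x e = x 0
      · exact ⟨0, le_rfl, by omega, block_succ_end h0 h⟩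
      · exact ⟨p, by omega, by omega, block_succ_end (h0.trans hbk.symm) (eq_of_ne_of_ne h hxp)⟩
    intro e
    obtain ⟨e₁, h1, h2, h3⟩ := hx.exists_rightSpecialAt_mem k (e - k)
    obtain ⟨t, rfl⟩ : ∃ t : ℕ, e = e₁ + t := ⟨(e - e₁).toNat, by omega⟩
    clear h1 h2
    induction t with
    | zero => simpa using base e₁ h3
    | succ t ih =>
      by_cases hr : RightSpecialAt x k (e₁ + (t + 1 : ℕ))
      · exact base _ hr
      obtain ⟨e', h4, h5, h6⟩ := ih
      have h7 : block x (e₁ + (t + 1 : ℕ) - k) k = block x (e' + 1 - k) k :=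
        block_eq_sub h6 (by push_cast; ring) (by push_cast; omega) (by push_cast; omega)
      have h8 : ¬ RightSpecialAt x k (e' + 1) := fun h => hr (h.congr h7)
      have h9 : e' + 1 ≠ p + q := fun h => h8 (by rwa [h])
      exact ⟨e' + 1, by omega, by omega,
        block_succ_end h7 (apply_eq_of_not_rightSpecialAt h8 h7)⟩
  have hinj : ∀ i : ℕ, ∀ j : ℤ, i < j → j < p + q → E i ≠ E j := by
    intro i
    induction i with
    | zero =>
      intro j h1 h2 hE
      have hj : RightSpecialAt x k j :=
        (hR k).congr (block_eq_sub hE.symm (by push_cast; ring) (by omega) (by omega))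
      have hjp : j = p := by
        by_contra hne
        rcases lt_or_gt_of_ne hne with h | h
        · exact hp' j (by omega) h hj
        · exact hq' j h h2 hj
      have := block_apply_eq hE k (by omega) (by omega)
      simp only [Nat.cast_zero, sub_add_cancel, hjp] at this
      exact hxp this.symm
    | succ i ih =>
      intro j h1 h2 hE
      have hb : block x (j - k) k = block x ((i + 1 : ℕ) - k) k :=
        block_eq_sub hE.symm (by ring) (by omega) (by omega)
      by_cases hr : RightSpecialAt x k (i + 1 : ℕ)
      · have hip : (p : ℤ) ≤ (i + 1 : ℕ) := by
          by_contra! h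
          exact hp' _ (by push_cast; omega) h hr
        exact hq' j (by omega) h2 (hr.congr hb)
      · have hl : ¬ LeftSpecialAt x k ((i + 1 : ℕ) - k) := by
          intro h
          exact hr ((hR k).congr (hx.leftSpecialAt_unique h hLk))
        have hl' : x (j - k - 1) = x ((i + 1 : ℕ) - k - 1) := by
          by_contra hne
          exact hl ⟨_, hb, hne⟩
        refine ih (j - 1) (by push_cast at h1; omega) (by omega) ?_
        have := block_eq_cons hb hl'
        simp only [E]
        rw [show (i : ℤ) - k = (i + 1 : ℕ) - k - 1 by push_cast; ring,
          show j - 1 - k = j - k - 1 by ring, this]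
  have hcard : p + q = k + 2 := by
    have h1 := hx.ncard_range_block (k + 1)
    have h2 : (Set.range fun i => block x i (k + 1)) = E '' (Finset.Ico (0 : ℤ) (p + q)) := by
      ext w
      constructor
      · rintro ⟨i, rfl⟩
        obtain ⟨e, h3, h4, h5⟩ := hsurj (i + k)
        refine ⟨e, by simp; omega, ?_⟩
        rw [← h5]
        simp [E]
      · rintro ⟨e, -, rfl⟩
        exact ⟨e - k, rfl⟩
    rw [h2, Set.InjOn.ncard_image, Set.ncard_coe_finset, Int.card_Ico] at h1
    · omega
    · intro i hi j hj hij
      simp only [Finset.coe_Ico, Set.mem_Ico] at hi hj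
      rcases lt_trichotomy i j with h | h | h
      · refine absurd ?_ (hinj i.toNat j (by omega) (by omega))
        rwa [Int.toNat_of_nonneg hi.1]
      · exact h
      · refine absurd ?_ (hinj j.toNat i (by omega) (by omega))
        rw [Int.toNat_of_nonneg hj.1, hij]
  have h2 : LeftSpecialAt x k (p + q - k) := hLk.congr (hx.rightSpecialAt_unique hq (hR k))
  rw [show (p : ℤ) + q - k = 2 by omega] at h2
  exact h2.mono hNk

theorem isCharacteristic_of_rightSpecialAt (hx : IsSturmian x) (hR : ∀ n, RightSpecialAt x n 0) :
    IsCharacteristic x := by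
  have hL := hx.leftSpecialAt_two hR
  have hne := hx.apply_zero_ne_apply_one hR hL
  by_cases h : x 0 = 0
  · exact Or.inl ⟨hx, hasSpecialCentre_iff.2 ⟨h, by omega, fun n => ⟨hR n, hL n⟩⟩⟩
  · exact Or.inr ⟨hx, hasSpecialCentre_iff.2 ⟨by omega, by omega, fun n => ⟨hR n, hL n⟩⟩⟩

/-! ### The string attractor of a characteristic word -/

/-- A set of `n + 1` places at which distinct blocks of length `n` start meets every factor. -/
theorem exists_mem_block_eq_of_injOn (hx : IsSturmian x) {n : ℕ} {S : Finset ℤ}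
    (hS : S.card = n + 1) (hinj : Set.InjOn (fun i => block x i n) S) (i : ℤ) :
    ∃ j ∈ S, block x j n = block x i n := by
  have h : (fun i => block x i n) '' S = Set.range fun i => block x i n := by
    refine Set.eq_of_subset_of_ncard_le (Set.image_subset_range _ _) ?_ (hx.finite_range_block n)
    rw [hinj.ncard_image, hx.ncard_range_block, Set.ncard_coe_finset, hS]
  have hi : block x i n ∈ (fun i => block x i n) '' S := h ▸ Set.mem_range_self i
  exact hi

/-- Around the centre of a characteristic word, the `n + 1` blocks of length `n` that meet the
positions `0` and `1` are distinct. -/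
theorem injOn_block_of_special (hx : IsSturmian x) (h01 : x 0 ≠ x 1)
    (hR : ∀ n, RightSpecialAt x n 0) (hL : ∀ n, LeftSpecialAt x n 2) (n : ℕ) :
    Set.InjOn (fun i => block x i n) (Finset.Icc (1 - n : ℤ) 1) := by
  suffices h : ∀ n : ℕ, ∀ i j : ℤ, 1 - (n : ℤ) ≤ i → i < j → j ≤ 1 → block x i n ≠ block x j n by
    intro i hi j hj hij
    simp only [Finset.coe_Icc, Set.mem_Icc] at hi hj
    rcases lt_trichotomy i j with hlt | heq | hlt
    · exact absurd hij (h n i j hi.1 hlt hj.2)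
    · exact heq
    · exact absurd hij.symm (h n j i hj.1 hlt hi.2)
  intro n
  induction n with
  | zero => intro i j h1 h2 h3; push_cast at h1; omega
  | succ n ih =>
    intro i j h1 h2 h3 hij
    push_cast at h1
    -- By induction, only the two outermost blocks could be equal.
    have hi : i = -n := by
      by_contra hne
      exact ih i j (by omega) h2 h3 (block_eq_sub hij (by ring) le_rfl (by omega))
    have hj : j = 1 := by
      by_contra hne
      exact ih (i + 1) (j + 1) (by omega) (by omega) (by omega)
        (block_eq_sub hij (by ring) (by omega) (by omega))
    subst hi hj
    have hinj : Set.InjOn (fun i => block x i n) (Finset.Icc (1 - n : ℤ) 1) := by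
      intro i hi j hj hij
      simp only [Finset.coe_Icc, Set.mem_Icc] at hi hj
      rcases lt_trichotomy i j with hlt | heq | hlt
      · exact absurd hij (ih i j hi.1 hlt hj.2)
      · exact heq
      · exact absurd hij.symm (ih j i hj.1 hlt hi.2)
    have hn : 0 < n := by
      by_contra! hn
      obtain rfl : n = 0 := by omega
      have := block_apply_eq hij 0 (by omega) (by omega)
      simp only [Nat.cast_zero, neg_zero, add_zero] at this
      exact h01 this
    -- Write `c = x 0`, `d = x 1` and let `u` be the common part of the special factors `d u` and
    -- `u c`.  The occurrence of `u d` found among the blocks that meet the centre is preceded by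
    -- `c`, so that `c u` is right-special, too.
    have h0 : x (-n) = x 1 := by simpa using block_apply_eq hij 0 le_rfl (by omega)
    have hc : x (n + 1) = x 0 := by
      have := block_apply_eq hij n (by omega) (by omega)
      simpa [add_comm] using this.symm
    obtain ⟨e, he, hxe⟩ := hR n
    rw [zero_sub] at he
    obtain ⟨j, hj, hje⟩ := hx.exists_mem_block_eq_of_injOn (S := Finset.Icc (1 - n : ℤ) 1)
      (by rw [Int.card_Icc]; omega) hinj (e - n + 1)
    rw [Finset.mem_Icc] at hj
    have hlast : x (j + n - 1) = x e := by
      have := block_apply_eq hje (n - 1) (by omega) (by omega)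
      rwa [← add_sub_assoc, show e - n + 1 + (n - 1 : ℤ) = e by ring] at this
    have hj1 : 1 - (n : ℤ) < j := by
      refine lt_of_le_of_ne hj.1 fun h => hxe ?_
      rw [← hlast, ← h]
      congr 1
      ring
    have hmid : block x j (n - 1) = block x (1 - n) (n - 1) := by
      have h1 : block x j (n - 1) = block x (e - n + 1) (n - 1) :=
        block_eq_sub hje (by ring) le_rfl (by omega)
      have h2 : block x (e - n + 1) (n - 1) = block x (1 - n) (n - 1) :=
        block_eq_sub he (by ring) (by omega) (by omega)
      exact h1.trans h2
    have hjc : x (j - 1) = x 0 := by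
      refine eq_of_ne_of_ne (c := x 1) (fun h => ?_) h01
      have h3 : block x (j - 1) (n - 1 + 1) = block x (-n) (n - 1 + 1) := by
        have := block_eq_cons hmid (by rw [h, ← h0]; congr 1; ring)
        rwa [show 1 - (n : ℤ) - 1 = -n by ring] at this
      rw [Nat.sub_add_cancel hn] at h3
      have h4 : block x (-n) n = block x 1 n := block_eq_sub hij (by ring) le_rfl (by omega)
      have := hinj (x₁ := j - 1) (x₂ := 1) (by simp; omega) (by simp) (h3.trans h4)
      omega
    obtain ⟨s, hs, hxs⟩ := hL n
    have hsc : x (s - 1) = x 0 := eq_of_ne_of_ne (c := x 1) (by simpa using hxs) h01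
    have hlast' : x (s + n - 1) = x 0 := by
      have := block_apply_eq hs (n - 1) (by omega) (by omega)
      rwa [← add_sub_assoc, show 2 + (n - 1 : ℤ) = n + 1 by ring, hc] at this
    have hmid' : block x s (n - 1) = block x j (n - 1) := by
      have h1 : block x s (n - 1) = block x 2 (n - 1) :=
        block_eq_sub hs (by ring) le_rfl (by omega)
      have h2 : block x 2 (n - 1) = block x (1 - n) (n - 1) :=
        block_eq_sub hij.symm (by ring) (by omega) (by omega)
      rw [h1, h2, hmid]
    have hsp : RightSpecialAt x n (j + n - 1) := by
      refine ⟨s + n - 1, ?_, by rw [hlast, hlast']; exact hxe.symm⟩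
      have := block_eq_cons hmid' (hsc.trans hjc.symm)
      rw [Nat.sub_add_cancel hn] at this
      rwa [show s + n - 1 - (n : ℤ) = s - 1 by ring, show j + n - 1 - (n : ℤ) = j - 1 by ring]
    have := block_apply_eq (hx.rightSpecialAt_unique hsp (hR n)) 0 le_rfl (by omega)
    rw [show j + n - 1 - (n : ℤ) + 0 = j - 1 by ring, show 0 - (n : ℤ) + 0 = -n by ring, hjc, h0]
      at this
    exact h01 this

theorem isStringAttractor_of_special (hx : IsSturmian x) (h01 : x 0 ≠ x 1)
    (hR : ∀ n, RightSpecialAt x n 0) (hL : ∀ n, LeftSpecialAt x n 2) :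
    IsStringAttractor x {0, 1} := by
  rintro w hw ⟨i, hi⟩
  have hlen : 0 < w.length := List.length_pos_iff.2 hw
  obtain ⟨j, hj, hji⟩ := hx.exists_mem_block_eq_of_injOn
    (S := Finset.Icc (1 - w.length : ℤ) 1) (by rw [Int.card_Icc]; omega)
    (hx.injOn_block_of_special h01 hR hL w.length) i
  rw [Finset.mem_Icc] at hj
  refine ⟨j, hji.trans hi, ?_⟩
  rcases eq_or_lt_of_le hj.2 with rfl | h
  · exact ⟨1, ⟨le_rfl, by omega⟩, by simp⟩
  · exact ⟨0, ⟨by omega, by omega⟩, by simp⟩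

/-! ### Bounded string attractors -/

/-- Bispecial factors of arbitrary length exist. -/
theorem exists_bispecial (hx : IsSturmian x) (N : ℕ) :
    ∃ k e, N ≤ k ∧ RightSpecialAt x k e ∧ LeftSpecialAt x k (e - k) := by
  obtain ⟨M, hM⟩ := hx.exists_rightSpecialAt_mem_apply_eq N
  obtain ⟨e, -, -, he, hxe⟩ := hM 0 0
  obtain ⟨f, hf, -, hf', hxf⟩ := hM (e + 1) 1
  obtain ⟨k, hk, hb, hne⟩ := hx.exists_longest_left_agreement (by omega)
    (hx.rightSpecialAt_unique hf' he)
  exact ⟨k, e, hk, ⟨f, hb, by rw [hxe, hxf]; decide⟩, ⟨_, hb, hne⟩⟩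

/-- The lengths of long bispecial factors are far apart. -/
theorem exists_forall_bispecial_lt (hx : IsSturmian x) (D : ℕ) :
    ∃ n₀ : ℕ, ∀ m k e f, n₀ ≤ m → m < k → RightSpecialAt x m e → LeftSpecialAt x m (e - m) →
      RightSpecialAt x k f → LeftSpecialAt x k (f - k) → m + D < k := by
  obtain ⟨n₀, h⟩ := hx.exists_forall_lt_sub D
  refine ⟨n₀, fun m k e f hm hmk he hle hf hlf => ?_⟩
  -- The bispecial factor of length `m` is both a suffix and a prefix of the one of length `k`.
  have h1 : RightSpecialAt x m (f - (k - m)) :=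
    he.congr (by
      rw [show f - (k - m) - (m : ℤ) = f - k by ring]
      exact hx.leftSpecialAt_unique (hlf.mono hmk.le) hle)
  have := h m hm _ _ h1 (hf.mono hmk.le) (by omega)
  omega

/-- Let every factor of length `n` occur among the blocks that meet `[a, b]`, and let the
right-special factor of length `n` end before `e` and before `f`.  If the two occurrences agreed
on a block of length `n + (b - a) - 1` and were not cut off by `[a, b]`, then `b - a` of the
`n + (b - a)` blocks that meet `[a, b]` would be superfluous, and too few would remain. -/
theorem not_agree_of_covered (hx : IsSturmian x) {a b e f : ℤ} {n : ℕ} (hn : 0 < n) (hab : a ≤ b)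
    (hcov : ∀ i, ∃ j, a - n < j ∧ j ≤ b ∧ block x j n = block x i n)
    (hef : e < f) (hbe : b ≤ e) (hf : f ≤ b + n)
    (hb : ∀ t : ℤ, 0 ≤ t → t < b - a → block x (f - n - t) n = block x (e - n - t) n) : False := by
  classical
  set S : Finset ℤ := Finset.Ioc (a - n) b with hS
  set J : Finset ℤ := Finset.Ioc (f - n - (b - a)) (f - n) with hJ
  have hJS : J ⊆ S := by
    intro j
    simp only [hS, hJ, Finset.mem_Ioc]
    omega
  have hcov' : ∀ i, ∃ j ∈ S \ J, block x j n = block x i n := by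
    have main : ∀ t : ℕ, ∀ j ∈ S, j = a - n + t → ∃ j' ∈ S \ J, block x j' n = block x j n := by
      intro t
      induction t using Nat.strong_induction_on with
      | _ t ih =>
        intro j hj hjt
        by_cases hjJ : j ∈ J
        · simp only [hJ, hS, Finset.mem_Ioc] at hj hjJ
          have h1 := hb (f - n - j) (by omega) (by omega)
          rw [show f - n - (f - n - j) = j by ring, show e - n - (f - n - j) = j - (f - e) by ring]
            at h1
          obtain ⟨j', h2, h3⟩ := ih (t - (f - e).toNat) (by omega) (j - (f - e))
            (by simp only [hS, Finset.mem_Ioc]; omega) (by omega)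
          exact ⟨j', h2, h3.trans h1.symm⟩
        · exact ⟨j, Finset.mem_sdiff.2 ⟨hj, hjJ⟩, rfl⟩
    intro i
    obtain ⟨j, h1, h2, h3⟩ := hcov i
    obtain ⟨j', h4, h5⟩ := main (j - (a - n)).toNat j (by simp only [hS, Finset.mem_Ioc]; omega)
      (by omega)
    exact ⟨j', h4, h5.trans h3⟩
  have h1 : (Set.range fun i => block x i n) ⊆ ((S \ J).image fun i => block x i n : Finset _) := by
    rintro _ ⟨i, rfl⟩
    obtain ⟨j, h1, h2⟩ := hcov' i
    exact Finset.mem_coe.2 (Finset.mem_image.2 ⟨j, h1, h2⟩)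
  have h2 := Set.ncard_le_ncard h1 (Finset.finite_toSet _)
  rw [hx.ncard_range_block, Set.ncard_coe_finset] at h2
  have h3 := Finset.card_image_le (s := S \ J) (f := fun i => block x i n)
  have h4 := Finset.card_sdiff_add_card_eq_card hJS
  have h5 : S.card = (b - (a - n)).toNat := Int.card_Ioc _ _
  have h6 : J.card = (f - n - (f - n - (b - a))).toNat := Int.card_Ioc _ _
  omega

/-- A bounded string attractor forces an occurrence of the infinite right-special word. -/
theorem exists_forall_rightSpecialAt (hx : IsSturmian x) {Γ : Set ℤ} {a b : ℤ}
    (hΓ : IsStringAttractor x Γ) (hΓab : Γ ⊆ Set.Icc a b) : ∃ ρ, ∀ n, RightSpecialAt x n ρ := by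
  have hcov : ∀ n : ℕ, 0 < n → ∀ i, ∃ j, a - n < j ∧ j ≤ b ∧ block x j n = block x i n := by
    intro n hn i
    obtain ⟨j, h1, g, h2, h3⟩ := hΓ (block x i n) (by
      rw [← List.length_pos_iff, length_block]; exact hn) ⟨i, by rw [length_block]⟩
    rw [length_block] at h1 h2
    have := hΓab h3
    exact ⟨j, by linarith [h2.2, this.1], h2.1.trans this.2, h1⟩
  have hab : a ≤ b := by
    obtain ⟨j, h1, h2, -⟩ := hcov 1 one_pos 0
    push_cast at h1
    omega
  have key : ∀ N : ℕ, ∃ e ∈ Finset.Icc a b, RightSpecialAt x N e := by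
    intro N
    obtain ⟨n₀, hn₀⟩ := hx.exists_forall_bispecial_lt ((b - a).toNat + 1)
    obtain ⟨m, e₀, hm, hre₀, hle₀⟩ := hx.exists_bispecial (max N n₀)
    -- As no bispecial factor has a length in `[m + 1, m + 1 + (b - a)]`, the first of two
    -- occurrences with distinct next letters is followed by a position in `[a, b]`.
    have hno : ∀ e f : ℤ, e < f → x e ≠ x f →
        block x (e - (m + 1 : ℕ)) (m + 1) = block x (f - (m + 1 : ℕ)) (m + 1) →
        f ≤ b + (m + 1 : ℕ) → e ≤ b := by
      intro e f hef hxef hb hf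
      by_contra! hbe
      obtain ⟨k, hk, hbk, hne⟩ := hx.exists_longest_left_agreement hef hb.symm
      have hmk := hn₀ m k e₀ e (by omega) (by omega) hre₀ hle₀ ⟨f, hbk, hxef.symm⟩ ⟨_, hbk, hne⟩
      refine hx.not_agree_of_covered (Nat.succ_pos m) hab (hcov (m + 1) (Nat.succ_pos m)) hef
        hbe.le hf fun t h0 ht => ?_
      exact block_eq_sub hbk (by ring) (by push_cast; omega) (by push_cast; omega)
    obtain ⟨M, hM⟩ := hx.exists_rightSpecialAt_mem_apply_eq (m + 1)
    have hocc : ∀ c : Fin 2, ∃ e, a ≤ e ∧ e ≤ b + (m + 1 : ℕ) ∧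
        RightSpecialAt x (m + 1) e ∧ x e = c := by
      intro c
      obtain ⟨e, -, -, he, hxe⟩ := hM 0 c
      obtain ⟨j, h1, h2, h3⟩ := hcov (m + 2) (by omega) (e - (m + 1 : ℕ))
      refine ⟨j + (m + 1 : ℕ), by push_cast at *; omega, by omega, he.congr ?_, ?_⟩
      · exact block_eq_sub h3 (by ring) (by omega) (by push_cast; omega)
      · have := block_apply_eq h3 (m + 1 : ℕ) (by omega) (by push_cast; omega)
        rw [this, ← hxe]
        congr 1
        ring
    obtain ⟨e, he1, he2, he3, he4⟩ := hocc 0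
    obtain ⟨f, hf1, hf2, hf3, hf4⟩ := hocc 1
    have hne : x e ≠ x f := by rw [he4, hf4]; decide
    have hb := hx.rightSpecialAt_unique he3 hf3
    rcases lt_trichotomy e f with h | h | h
    · exact ⟨e, Finset.mem_Icc.2 ⟨he1, hno e f h hne hb hf2⟩, he3.mono (by omega)⟩
    · exact absurd (congrArg x h) hne
    · exact ⟨f, Finset.mem_Icc.2 ⟨hf1, hno f e h hne.symm hb.symm he2⟩, hf3.mono (by omega)⟩
  by_contra! h
  choose N hN using h
  obtain ⟨e, he, hs⟩ := key ((Finset.Icc a b).sup N)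
  exact hN e (hs.mono (Finset.le_sup he))

end IsSturmian

/-! ### Spans of sets -/

theorem sub_le_setSpan {Γ : Set ℤ} {a b : ℤ} (ha : a ∈ Γ) (hb : b ∈ Γ) :
    (((b : ℝ) - (a : ℝ) : ℝ) : EReal) ≤ setSpan Γ := by
  rw [EReal.coe_sub]
  exact EReal.sub_le_sub (le_iSup₂_of_le b hb le_rfl) (iInf₂_le_of_le a ha le_rfl)

theorem setSpan_pair (k : ℤ) : setSpan {k, k + 1} = 1 := by
  have h : ((k : ℝ) : EReal) ≤ (((k + 1 : ℤ) : ℝ) : EReal) := by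
    rw [EReal.coe_le_coe_iff]
    push_cast
    linarith
  rw [setSpan, iSup_pair, iInf_pair, sup_eq_right.2 h, inf_eq_left.2 h, ← EReal.coe_sub]
  norm_num

theorem subset_Icc_of_setSpan_ne_top {Γ : Set ℤ} (h : setSpan Γ ≠ ⊤) :
    ∃ a b, Γ ⊆ Set.Icc a b := by
  rcases Γ.eq_empty_or_nonempty with rfl | ⟨g, hg⟩
  · exact ⟨0, 0, Set.empty_subset _⟩
  obtain ⟨R, hR, -⟩ := EReal.lt_iff_exists_real_btwn.1 (lt_top_iff_ne_top.2 h)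
  have hlt : ∀ a ∈ Γ, ∀ b ∈ Γ, b - a ≤ ⌈R⌉ := by
    intro a ha b hb
    have h1 := EReal.coe_lt_coe_iff.1 ((sub_le_setSpan ha hb).trans_lt hR)
    have h2 := h1.le.trans (Int.le_ceil R)
    exact_mod_cast h2
  refine ⟨g - ⌈R⌉, g + ⌈R⌉, fun a ha => ⟨?_, ?_⟩⟩
  · linarith [hlt a ha g hg]
  · linarith [hlt g hg a ha]

theorem IsStringAttractor.of_shift {A : Type*} {x : Word A} {k : ℤ} {Γ Γ' : Set ℤ}
    (h : IsStringAttractor (shift k x) Γ) (hΓ : ∀ g ∈ Γ, g + k ∈ Γ') : IsStringAttractor x Γ' := by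
  rintro w hw ⟨i, hi⟩
  obtain ⟨j, h1, g, h2, h3⟩ := h w hw ⟨i - k, by rw [block_shift, sub_add_cancel, hi]⟩
  rw [block_shift] at h1
  exact ⟨j + k, h1, g + k, ⟨by linarith [h2.1], by linarith [h2.2]⟩, hΓ g h3⟩

/-! ### Orbit closures -/

section Topology

variable {A : Type*} [TopologicalSpace A]

theorem isClosed_setOf_block_eq [DiscreteTopology A] (i j : ℤ) (n : ℕ) (y : Word A) :
    IsClosed {z : Word A | block z i n = block y j n} := by
  simp only [block_eq_iff, Set.ofPred_forall]
  exact isClosed_iInter fun k => isClosed_iInter fun _ =>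
    isClosed_eq (continuous_apply _) continuous_const

theorem isOpen_setOf_block_eq [DiscreteTopology A] (i j : ℤ) (n : ℕ) (y : Word A) :
    IsOpen {z : Word A | block z i n = block y j n} := by
  have : {z : Word A | block z i n = block y j n} =
      ⋂ k ∈ Set.Iio n, {z : Word A | z (i + k) = y (j + k)} := by
    ext z
    simp [block_eq_iff]
  rw [this]
  refine (Set.finite_Iio n).isOpen_biInter fun k _ => ?_
  have hc : Continuous fun z : Word A => z (i + k) := continuous_apply _
  exact (isOpen_discrete {y (j + k)}).preimage hc

theorem exists_forall_block_eq_mem {U : Set (Word A)} (hU : IsOpen U) {y : Word A} (hy : y ∈ U) :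
    ∃ N : ℕ, ∀ z, block z (-(N : ℤ)) (2 * N + 1) = block y (-(N : ℤ)) (2 * N + 1) → z ∈ U := by
  obtain ⟨I, u, hu, hI⟩ := isOpen_pi_iff.1 hU y hy
  refine ⟨I.sup Int.natAbs, fun z hz => hI fun i hi => ?_⟩
  have hle : i.natAbs ≤ I.sup Int.natAbs := Finset.le_sup (f := Int.natAbs) hi
  have := block_apply_eq hz (i + (I.sup Int.natAbs : ℕ)) (by omega) (by push_cast; omega)
  rw [neg_add_cancel_comm_assoc] at this
  rw [this]
  exact (hu i hi).2

theorem mem_orbitClosure_iff [DiscreteTopology A] {x y : Word A} :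
    y ∈ orbitClosure x ↔ ∀ i n, ∃ j, block y i n = block x j n := by
  constructor
  · intro h i n
    obtain ⟨_, hz, k, rfl⟩ := mem_closure_iff.1 h _ (isOpen_setOf_block_eq i i n y) rfl
    exact ⟨i + k, by rw [← block_shift]; exact hz.symm⟩
  · intro h
    refine mem_closure_iff.2 fun U hU hy => ?_
    obtain ⟨N, hN⟩ := exists_forall_block_eq_mem hU hy
    obtain ⟨j, hj⟩ := h (-(N : ℤ)) (2 * N + 1)
    refine ⟨shift (j + N) x, hN _ ?_, j + N, rfl⟩
    rw [block_shift, hj]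
    congr 1
    ring

theorem shift_mem_orbitClosure [DiscreteTopology A] {x y : Word A} (hy : y ∈ orbitClosure x)
    (k : ℤ) :
    shift k y ∈ orbitClosure x := by
  rw [mem_orbitClosure_iff] at hy ⊢
  intro i n
  rw [block_shift]
  exact hy _ n

theorem shift_mem_orbitClosure_self (x : Word A) (k : ℤ) : shift k x ∈ orbitClosure x :=
  subset_closure ⟨k, rfl⟩

end Topology

/-- Being right-special depends only on the set of factors. -/
theorem RightSpecialAt.transfer {A : Type*} {x y : Word A}
    (hxy : ∀ i n, ∃ j, block x i n = block y j n) {n : ℕ} {e f : ℤ} (h : RightSpecialAt x n e)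
    (hb : block y (f - n) n = block x (e - n) n) : RightSpecialAt y n f := by
  have occ : ∀ e', block x (e' - n) n = block x (e - n) n →
      ∃ f', block y (f' - n) n = block y (f - n) n ∧ y f' = x e' := by
    intro e' he'
    obtain ⟨j, hj⟩ := hxy (e' - n) (n + 1)
    refine ⟨j + n, ?_, ?_⟩
    · rw [add_sub_cancel_right, hb, ← he']
      exact (block_eq_sub hj (by ring) le_rfl (by omega)).symm
    · simpa using (block_apply_eq hj n (by omega) (by omega)).symm
  obtain ⟨e', h1, h2⟩ := h
  obtain ⟨f₁, h3, h4⟩ := occ e rfl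
  obtain ⟨f₂, h5, h6⟩ := occ e' h1
  by_cases hf : y f₁ = y f
  · exact ⟨f₂, h5, fun h => h2 (by rw [← h6, ← h4, h, hf])⟩
  · exact ⟨f₁, h3, hf⟩

/-- Being left-special depends only on the set of factors. -/
theorem LeftSpecialAt.transfer {A : Type*} {x y : Word A}
    (hxy : ∀ i n, ∃ j, block x i n = block y j n) {n : ℕ} {s t : ℤ} (h : LeftSpecialAt x n s)
    (hb : block y t n = block x s n) : LeftSpecialAt y n t := by
  have occ : ∀ s', block x s' n = block x s n →
      ∃ t', block y t' n = block y t n ∧ y (t' - 1) = x (s' - 1) := by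
    intro s' hs'
    obtain ⟨j, hj⟩ := hxy (s' - 1) (n + 1)
    refine ⟨j + 1, ?_, ?_⟩
    · rw [hb, ← hs']
      exact (block_eq_sub hj (by ring) (by omega) (by push_cast; omega)).symm
    · simpa using (block_apply_eq hj 0 (by omega) (by omega)).symm
  obtain ⟨s', h1, h2⟩ := h
  obtain ⟨t₁, h3, h4⟩ := occ s rfl
  obtain ⟨t₂, h5, h6⟩ := occ s' h1
  by_cases hf : y (t₁ - 1) = y (t - 1)
  · exact ⟨t₂, h5, fun h => h2 (by rw [← h6, ← h4, h, hf])⟩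
  · exact ⟨t₁, h3, hf⟩

namespace IsSturmian

variable {x y z : Word (Fin 2)}

/-- Sturmian shift spaces are minimal: each element has all the factors. -/
theorem exists_block_eq_of_mem (hx : IsSturmian x) (hy : y ∈ orbitClosure x) (i : ℤ) (n : ℕ) :
    ∃ j, block x i n = block y j n := by
  obtain ⟨M, hM⟩ := hx.exists_forall_block_eq n i
  obtain ⟨j, hj⟩ := mem_orbitClosure_iff.1 hy 0 (M + n)
  obtain ⟨k, h1, h2, h3⟩ := hM j
  refine ⟨k - j, ?_⟩
  rw [← h3]
  exact (block_eq_sub hj (by ring) (by omega) (by push_cast; omega)).symm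

theorem exists_block_eq_of_mem_of_mem (hx : IsSturmian x) (hy : y ∈ orbitClosure x)
    (hz : z ∈ orbitClosure x) (i : ℤ) (n : ℕ) : ∃ j, block y i n = block z j n := by
  obtain ⟨j, hj⟩ := mem_orbitClosure_iff.1 hy i n
  obtain ⟨k, hk⟩ := hx.exists_block_eq_of_mem hz j n
  exact ⟨k, hj.trans hk⟩

theorem of_mem_orbitClosure (hx : IsSturmian x) (hy : y ∈ orbitClosure x) : IsSturmian y := by
  -- Long `p`-periodic factors of `y` would contain long right-special factors of `x`.
  have hnot : ∀ p : ℕ, 0 < p → ∀ s : ℕ → ℤ,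
      ¬ ∀ n : ℕ, ∀ k, s n + p ≤ k → k < s n + 2 * n → y k = y (k - p) := by
    intro p hp s hper
    obtain ⟨n, hn⟩ := hx.exists_forall_not_period hp
    obtain ⟨j, hj⟩ := mem_orbitClosure_iff.1 hy (s n) (2 * n)
    obtain ⟨e, h1, h2, he⟩ := hx.exists_rightSpecialAt_mem n (j + n)
    obtain ⟨k, h3, h4, hne⟩ := hn n le_rfl e he
    have h5 := hper n (s n + (k - j)) (by omega) (by omega)
    have h6 := block_apply_eq hj (k - j) (by omega) (by push_cast; omega)
    have h7 := block_apply_eq hj (k - j - p) (by omega) (by push_cast; omega)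
    rw [h6, add_sub_assoc, h7, add_sub_cancel, ← add_sub_assoc, add_sub_cancel] at h5
    exact hne h5
  refine ⟨fun n => ?_, ?_⟩
  · rw [← hx.1 n, complexity, complexity, setOf_isFactor_eq_range, setOf_isFactor_eq_range]
    congr 1
    apply Set.Subset.antisymm
    · rintro _ ⟨i, rfl⟩
      exact (mem_orbitClosure_iff.1 hy i n).imp fun j hj => hj.symm
    · rintro _ ⟨i, rfl⟩
      exact (hx.exists_block_eq_of_mem hy i n).imp fun j hj => hj.symm
  · rintro (⟨N, p, hp, h⟩ | ⟨N, p, hp, h⟩)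
    · refine hnot p hp (fun _ => N) fun n k h1 _ => ?_
      have := h (k - p) (by omega)
      rw [this, sub_add_cancel]
    · exact hnot p hp (fun n => N - 2 * n) fun n k _ h2 => h k (by omega)

theorem isCharacteristicUpToShift_of_rightSpecialAt (hx : IsSturmian x) {ρ : ℤ}
    (h : ∀ n, RightSpecialAt x n ρ) : IsCharacteristicUpToShift x := by
  have hmem := shift_mem_orbitClosure_self x ρ
  refine ⟨ρ, (hx.of_mem_orbitClosure hmem).isCharacteristic_of_rightSpecialAt fun n => ?_⟩
  refine (h n).transfer (hx.exists_block_eq_of_mem hmem) ?_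
  rw [block_shift]
  congr 1
  ring

theorem one_le_span (hx : IsSturmian x) : 1 ≤ span x := by
  refine le_iInf₂ fun Γ hΓ => ?_
  have hmem : ∀ i, ∃ g ∈ Γ, x g = x i := by
    intro i
    obtain ⟨j, h1, g, h2, h3⟩ := hΓ (block x i 1) (by simp [block]) ⟨i, by rw [length_block]⟩
    simp only [length_block, Set.mem_Ico, Nat.cast_one] at h1 h2
    obtain rfl : g = j := by omega
    exact ⟨g, h3, by simpa using block_apply_eq h1 0 le_rfl (by simp)⟩
  obtain ⟨k, -, hk⟩ := hx.not_forall_eq_of_ge (x 0) 0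
  obtain ⟨a, ha, hxa⟩ := hmem 0
  obtain ⟨b, hb, hxb⟩ := hmem k
  have key : ∀ a ∈ Γ, ∀ b ∈ Γ, a < b → 1 ≤ setSpan Γ := by
    intro a ha b hb hab
    refine le_trans ?_ (sub_le_setSpan ha hb)
    rw [← EReal.coe_one, EReal.coe_le_coe_iff]
    have : ((a + 1 : ℤ) : ℝ) ≤ b := Int.cast_le.2 hab
    push_cast at this
    linarith
  rcases lt_trichotomy a b with h | h | h
  · exact key a ha b hb h
  · exact absurd (by rw [← hxa, ← hxb, h]) hk
  · exact key b hb a ha h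

theorem span_eq_one (hx : IsSturmian x) (h : IsCharacteristicUpToShift x) : span x = 1 := by
  refine le_antisymm ?_ hx.one_le_span
  obtain ⟨k, hk⟩ := h
  obtain ⟨hs, h01, hRL⟩ : IsSturmian (shift k x) ∧ shift k x 0 ≠ shift k x 1 ∧
      ∀ n, RightSpecialAt (shift k x) n 0 ∧ LeftSpecialAt (shift k x) n 2 := by
    rcases hk with ⟨hs, hc⟩ | ⟨hs, hc⟩ <;>
    · obtain ⟨h0, h1, h2⟩ := hasSpecialCentre_iff.1 hc
      exact ⟨hs, by rw [h0, h1]; decide, h2⟩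
  have hatt := hs.isStringAttractor_of_special h01 (fun n => (hRL n).1) fun n => (hRL n).2
  rw [← setSpan_pair k]
  refine iInf₂_le _ (hatt.of_shift ?_)
  rintro g (rfl | rfl)
  · simp
  · simp [add_comm]

theorem span_eq_top (hx : IsSturmian x) (h : ¬ IsCharacteristicUpToShift x) : span x = ⊤ := by
  refine iInf₂_eq_top.2 fun Γ hΓ => ?_
  by_contra hne
  obtain ⟨a, b, hab⟩ := subset_Icc_of_setSpan_ne_top hne
  obtain ⟨ρ, hρ⟩ := hx.exists_forall_rightSpecialAt hΓ hab
  exact h (hx.isCharacteristicUpToShift_of_rightSpecialAt hρ)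

/-! ### Elements of given span in a Sturmian shift space -/

theorem shift_injective (hx : IsSturmian x) : Function.Injective fun k : ℤ => shift k x := by
  have : ∀ i j : ℤ, i < j → shift i x ≠ shift j x := by
    intro i j hij h
    refine hx.2 (Or.inl ⟨0, (j - i).toNat, by omega, fun n _ => ?_⟩)
    have h1 := congrFun h (n - i)
    simp only [shift, sub_add_cancel] at h1
    rw [h1]
    congr 1
    omega
  intro i j hij
  rcases lt_trichotomy i j with h | h | h
  · exact absurd hij (this i j h)
  · exact h
  · exact absurd hij.symm (this j i h)

/-- By compactness, a Sturmian shift space contains a word whose left half is the infinite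
right-special word. -/
theorem exists_mem_forall_rightSpecialAt (hx : IsSturmian x) :
    ∃ y ∈ orbitClosure x, ∀ n, RightSpecialAt y n 0 := by
  choose e he using hx.exists_rightSpecialAt
  have hclosed : ∀ n : ℕ, IsClosed
      (orbitClosure x ∩ {y | block y (0 - (n : ℤ)) n = block x (e n - n) n}) :=
    fun n => isClosed_closure.inter (isClosed_setOf_block_eq _ _ n x)
  obtain ⟨y, hy⟩ := IsCompact.nonempty_iInter_of_sequence_nonempty_isCompact_isClosed
    (fun n : ℕ => orbitClosure x ∩ {y | block y (0 - (n : ℤ)) n = block x (e n - n) n})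
    (fun n y hy => ⟨hy.1, by
      have h1 : block x (e (n + 1) - n) n = block x (e n - n) n :=
        hx.rightSpecialAt_unique ((he (n + 1)).mono n.le_succ) (he n)
      exact (block_eq_sub hy.2 (by ring) (by omega) (by push_cast; omega)).trans h1⟩)
    (fun n => ⟨shift (e n) x, shift_mem_orbitClosure_self x _, by
      rw [Set.mem_ofPred_eq, block_shift]; congr 1; ring⟩)
    (hclosed 0).isCompact hclosed
  rw [Set.mem_iInter] at hy
  exact ⟨y, (hy 0).1, fun n => (he n).transfer (hx.exists_block_eq_of_mem (hy 0).1) (hy n).2⟩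

theorem infinite_span_eq_one (hx : IsSturmian x) :
    {y ∈ orbitClosure x | span y = 1}.Infinite := by
  obtain ⟨y, hy, hR⟩ := hx.exists_mem_forall_rightSpecialAt
  have hys := hx.of_mem_orbitClosure hy
  refine Set.infinite_of_injective_forall_mem hys.shift_injective fun k => ?_
  refine ⟨shift_mem_orbitClosure hy k,
    (hx.of_mem_orbitClosure (shift_mem_orbitClosure hy k)).span_eq_one ⟨-k, ?_⟩⟩
  have : shift (-k) (shift k y) = y := by
    ext1 i
    simp [shift]
  rw [this]
  exact hys.isCharacteristic_of_rightSpecialAt hR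

/-- A word with given central letters and special halves is unique in its shift space. -/
theorem eq_of_hasSpecialCentre (hx : IsSturmian x) (hy : y ∈ orbitClosure x)
    (hz : z ∈ orbitClosure x) {c d : Fin 2} (hyc : HasSpecialCentre y c d)
    (hzc : HasSpecialCentre z c d) : y = z := by
  obtain ⟨hy0, hy1, hy2⟩ := hasSpecialCentre_iff.1 hyc
  obtain ⟨hz0, hz1, hz2⟩ := hasSpecialCentre_iff.1 hzc
  have hys := hx.of_mem_orbitClosure hy
  have hyz := hx.exists_block_eq_of_mem_of_mem hy hz
  have hzy := hx.exists_block_eq_of_mem_of_mem hz hy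
  ext1 i
  rcases lt_or_ge i 0 with hi | hi
  · obtain ⟨f, hf⟩ := hzy (0 - ((-i).toNat : ℤ)) (-i).toNat
    have h1 : RightSpecialAt y (-i).toNat (f + (-i).toNat) :=
      (hz2 _).1.transfer hzy (by rw [add_sub_cancel_right, hf])
    have h2 := hys.rightSpecialAt_unique (hy2 (-i).toNat).1 h1
    rw [add_sub_cancel_right, ← hf] at h2
    have := block_apply_eq h2 0 le_rfl (by omega)
    rwa [show 0 - ((-i).toNat : ℤ) + 0 = i by omega] at this
  rcases le_or_gt 2 i with hi' | hi'
  · obtain ⟨f, hf⟩ := hzy 2 i.toNat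
    have h1 : LeftSpecialAt y i.toNat f := (hz2 _).2.transfer hzy hf.symm
    have h2 := hys.leftSpecialAt_unique (hy2 i.toNat).2 h1
    rw [← hf] at h2
    have := block_apply_eq h2 (i - 2) (by omega) (by omega)
    rwa [show 2 + (i - 2) = i by ring] at this
  obtain rfl | rfl : i = 0 ∨ i = 1 := by omega
  · rw [hy0, hz0]
  · rw [hy1, hz1]

theorem countable_span_eq_one (hx : IsSturmian x) :
    {y ∈ orbitClosure x | span y = 1}.Countable := by
  have hsub : {y ∈ orbitClosure x | span y = 1} ⊆ ⋃ (k : ℤ) (c : Fin 2) (d : Fin 2),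
      {y ∈ orbitClosure x | HasSpecialCentre (shift k y) c d} := by
    rintro y ⟨hy, hspan⟩
    have hchar : IsCharacteristicUpToShift y := by
      by_contra h
      rw [(hx.of_mem_orbitClosure hy).span_eq_top h] at hspan
      exact absurd hspan (by decide)
    obtain ⟨k, ⟨-, h⟩ | ⟨-, h⟩⟩ := hchar
    · exact Set.mem_iUnion.2 ⟨k, Set.mem_iUnion₂.2 ⟨0, 1, hy, h⟩⟩
    · exact Set.mem_iUnion.2 ⟨k, Set.mem_iUnion₂.2 ⟨1, 0, hy, h⟩⟩
  refine Set.Countable.mono hsub (Set.countable_iUnion fun k => Set.countable_iUnion fun c =>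
    Set.countable_iUnion fun d => Set.Subsingleton.countable ?_)
  rintro y ⟨hy, hyc⟩ z ⟨hz, hzc⟩
  have := hx.eq_of_hasSpecialCentre (shift_mem_orbitClosure hy k) (shift_mem_orbitClosure hz k)
    hyc hzc
  ext1 i
  simpa [shift] using congrFun this (i - k)

/-- By uniform recurrence, a Sturmian shift space has no isolated point. -/
theorem not_countable_orbitClosure (hx : IsSturmian x) : ¬ (orbitClosure x).Countable := by
  intro hc
  have : Countable (orbitClosure x) := hc.to_subtype
  have : CompactSpace (orbitClosure x) := isCompact_iff_compactSpace.1 isClosed_closure.isCompact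
  have : Nonempty (orbitClosure x) := ⟨⟨_, shift_mem_orbitClosure_self x 0⟩⟩
  obtain ⟨z, w, hw⟩ := nonempty_interior_of_iUnion_of_closed
    (f := fun z : orbitClosure x => ({z} : Set (orbitClosure x)))
    (fun z => isClosed_singleton) (Set.iUnion_of_singleton _)
  obtain ⟨V, hVsub, hV, hwV⟩ := mem_interior.1 hw
  obtain rfl : w = z := hVsub hwV
  obtain ⟨U, hU, rfl⟩ := isOpen_induced_iff.1 hV
  obtain ⟨N, hN⟩ := exists_forall_block_eq_mem hU hwV
  have hws := hx.of_mem_orbitClosure w.2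
  obtain ⟨M, hM⟩ := hws.exists_forall_block_eq (2 * N + 1) (-(N : ℤ))
  obtain ⟨k, hk, -, hb⟩ := hM (-N + 1)
  have hmem : shift (k + N) (w : Word (Fin 2)) ∈ U := hN _ (by
    rw [block_shift, ← hb]
    congr 1
    ring)
  have heq : shift (k + N) (w : Word (Fin 2)) = w :=
    congrArg Subtype.val (hVsub (a := ⟨_, shift_mem_orbitClosure w.2 _⟩) hmem)
  have h0 : shift (k + N) (w : Word (Fin 2)) = shift 0 w := by
    rw [heq]
    ext1 i
    simp [shift]
  have := hws.shift_injective h0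
  omega

end IsSturmian
end BiInfinite

theorem theoremT :
    (∀ x : BiInfinite.Word (Fin 2), BiInfinite.IsSturmian x →
      (BiInfinite.IsCharacteristicUpToShift x → BiInfinite.span x = 1) ∧
      (¬ BiInfinite.IsCharacteristicUpToShift x → BiInfinite.span x = ⊤)) ∧
    (∀ X : Set (BiInfinite.Word (Fin 2)), BiInfinite.IsSturmianShift X →
      ({x ∈ X | BiInfinite.span x = 1}.Countable ∧ {x ∈ X | BiInfinite.span x = 1}.Infinite) ∧
      ¬ {x ∈ X | BiInfinite.span x = ⊤}.Countable) := by
  refine ⟨fun x hx => ⟨hx.span_eq_one, hx.span_eq_top⟩, ?_⟩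
  rintro _ ⟨x, hx, rfl⟩
  refine ⟨⟨hx.countable_span_eq_one, hx.infinite_span_eq_one⟩, fun htop => ?_⟩
  refine hx.not_countable_orbitClosure ((hx.countable_span_eq_one.union htop).mono fun y hy => ?_)
  by_cases h : BiInfinite.IsCharacteristicUpToShift y
  · exact Or.inl ⟨hy, (hx.of_mem_orbitClosure hy).span_eq_one h⟩
  · exact Or.inr ⟨hy, (hx.of_mem_orbitClosure hy).span_eq_top h⟩
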